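/- Let $m\ge 1$. A (non-global) Parikh tree automaton of dimension $m$ ($m$-PTA) is a tuple $\mathcal A=(Q,\Sigma,q_0,\Delta,C)$ where $Q$ is a finite set of states, $\Sigma$ is a finite ranked alphabet, $q_0\in Q$ is the initial state, $C\subseteq\mathbb N^m$ is a semilinear set (a finite union of sets $\{d_0+\sum_{i=1}^{l}n_id_i\mid n_1,\dots,n_l\in\mathbb N\}$ with $d_0,\dots,d_l\in\mathbb N^m$), and $\Delta$ is a finite set of transitions of the form $q\to\sigma(q_1(d_1),\dots,q_n(d_n))$ where $\sigma\in\Sigma$ has rank $n\ge 0$, $q,q_1,\dots,q_n\in Q$ and $d_1,\dots,d_n\in\mathbb N^m$. The automaton rewrites trees over $\Sigma$ some of whose leaves are labelled by configurations $(q,w)\in Q\times\mathbb N^m$: in one step, for some transition as above, a leaf $(q,w)$ is replaced by $\sigma((q_1,w+d_1),\dots,(q_n,w+d_n))$ if $n\ge 1$, and by the leaf $\sigma$ if $n=0$ and $w\in C$. The tree language $L(\mathcal A)$ is the set of all trees over $\Sigma$ that can be obtained from $(q_0,\mathbf 0)$ in finitely many steps. **Theorem.** For every $m\ge 3$ the non-emptiness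 problem of $m$-PTA is undecidable: there is no algorithm that decides, given an $m$-PTA $\mathcal A$ (by a list of its states, symbols with their ranks and transitions, its initial state, and $C$ by the base vectors and period vectors of finitely many linear sets with union $C$), whether $L(\mathcal A)\ne\emptyset$. -/

import Mathlib

/-- The set `T_Σ(H)` of trees over the ranked set `(S, rk)`, indexed by `H`. -/
inductive RTree {S : Type*} (rk : S → ℕ) (H : Type*) where
  | leaf (h : H) : RTree rk H
  | node (σ : S) (children : Fin (rk σ) → RTree rk H) : RTree rk H

namespace RTree

variable {S : Type*} {rk : S → ℕ} {H : Type*}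

/-- The inclusion `T_Σ = T_Σ(∅) ⊆ T_Σ(H)`. -/
def embed : RTree rk Empty → RTree rk H
  | leaf h => h.elim
  | node σ c => node σ fun i => embed (c i)

end RTree

/-- Contexts in `C_Σ(H, X₁)`, that is, trees over `S` and `H` with exactly one hole. In
`node σ i siblings ζ` the hole lies in the `i`-th subtree, which is `ζ`; the entry `siblings i`
is irrelevant. -/
inductive RContext {S : Type*} (rk : S → ℕ) (H : Type*) where
  | hole : RContext rk H
  | node (σ : S) (i : Fin (rk σ)) (siblings : Fin (rk σ) → RTree rk H) (ζ : RContext rk H) :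
      RContext rk H

/-- The composition `ζ · ξ`: the hole of `ζ` is replaced by `ξ`. -/
def RContext.plug {S : Type*} {rk : S → ℕ} {H : Type*} :
    RContext rk H → RTree rk H → RTree rk H
  | hole, ξ => ξ
  | node σ i siblings ζ, ξ => RTree.node σ (Function.update siblings i (ζ.plug ξ))

/-- Storage operations: `some d` adds the vector `d`, and `none` is the reset. -/
abbrev StorageOp (m : ℕ) : Type := Option (Fin m → ℕ)

/-- The effect of a storage operation on a counter configuration. -/
def StorageOp.apply {m : ℕ} (w : Fin m → ℕ) : StorageOp m → (Fin m → ℕ)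
  | some d => w + d
  | none => 0

/-- Transitions `q → σ(q₁(d₁), …, qₙ(dₙ))`, where `n` is the rank of `σ`. -/
structure PTARTransition (m : ℕ) (Q : Type*) {S : Type*} (rk : S → ℕ) where
  src : Q
  sym : S
  tgt : Fin (rk sym) → Q
  op : Fin (rk sym) → StorageOp m

/-- Non-global Parikh tree automata of dimension `m` with reset operation, with the finite set `Q`
of states and over the ranked alphabet `(S, rk)`. -/
structure PTAR (m : ℕ) (Q : Type*) {S : Type*} [Finite Q] [Finite S] (rk : S → ℕ) where
  init : Q
  trans : Set (PTARTransition m Q rk)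
  trans_finite : trans.Finite
  accept : Set (Fin m → ℕ)
  accept_semilinear : IsSemilinearSet accept

namespace PTAR

variable {m : ℕ} {Q S : Type*} [Finite Q] [Finite S] {rk : S → ℕ}

/-- An `m`-PTA is an `m`-PTAR in whose transitions the reset does not occur. -/
def IsPTA (A : PTAR m Q rk) : Prop :=
  ∀ τ ∈ A.trans, ∀ i, τ.op i ≠ none

/-- One application of the transition `τ` at the root of a tree that consists of a single
automaton configuration. For a symbol of rank `0` there are no subtrees (so that `c` is the empty
family), and the counter configuration has to belong to the semilinear set. -/
inductive Rewrite (A : PTAR m Q rk) (τ : PTARTransition m Q rk) :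
    RTree rk (Q × (Fin m → ℕ)) → RTree rk (Q × (Fin m → ℕ)) → Prop
  | inner (w : Fin m → ℕ) (h : 1 ≤ rk τ.sym) :
      Rewrite A τ (.leaf (τ.src, w))
        (.node τ.sym fun i => .leaf (τ.tgt i, StorageOp.apply w (τ.op i)))
  | nullary (w : Fin m → ℕ) (h : rk τ.sym = 0) (hw : w ∈ A.accept)
      (c : Fin (rk τ.sym) → RTree rk (Q × (Fin m → ℕ))) :
      Rewrite A τ (.leaf (τ.src, w)) (.node τ.sym c)

/-- The computation relation: some transition is applied inside some context. -/
def Step (A : PTAR m Q rk) (ζ₁ ζ₂ : RTree rk (Q × (Fin m → ℕ))) : Prop :=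
  ∃ τ ∈ A.trans, ∃ (ζ : RContext rk (Q × (Fin m → ℕ))) (ξ₁ ξ₂ : RTree rk (Q × (Fin m → ℕ))),
    ζ₁ = ζ.plug ξ₁ ∧ ζ₂ = ζ.plug ξ₂ ∧ A.Rewrite τ ξ₁ ξ₂

/-- The recognized tree language: all `ξ ∈ T_Σ` with a computation from `(q₀, 0)` to `ξ`. -/
def language (A : PTAR m Q rk) : Set (RTree rk Empty) :=
  {ξ | Relation.ReflTransGen A.Step (.leaf (A.init, 0)) ξ.embed}

end PTAR

/-- Finite descriptions of automata, as inputs of algorithms: the number of states (which are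
`0, 1, …`), the list of the ranks of the symbols (which are `0, 1, …`), the initial state, the list
of the transitions `(q, σ, [(q₁, d₁), …, (qₙ, dₙ)])`, and the semilinear set, as a list of pairs of
a base vector and a list of period vectors. -/
structure PTARCode (m : ℕ) where
  numStates : ℕ
  ranks : List ℕ
  init : ℕ
  trans : List (ℕ × ℕ × List (ℕ × StorageOp m))
  accept : List ((Fin m → ℕ) × List (Fin m → ℕ))

namespace PTARCode

/-- A description is a tuple of its five components. -/
def equivProd (m : ℕ) : PTARCode m ≃
    ℕ × List ℕ × ℕ × List (ℕ × ℕ × List (ℕ × StorageOp m)) ×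
      List ((Fin m → ℕ) × List (Fin m → ℕ)) where
  toFun c := (c.numStates, c.ranks, c.init, c.trans, c.accept)
  invFun p := ⟨p.1, p.2.1, p.2.2.1, p.2.2.2.1, p.2.2.2.2⟩
  left_inv _ := rfl
  right_inv _ := rfl

instance instPrimcodable (m : ℕ) : Primcodable (PTARCode m) :=
  Primcodable.ofEquiv _ (equivProd m)

end PTARCode

/-- The linear set with base vector `b` and list `ps` of period vectors. -/
def linearSetOf {m : ℕ} (b : Fin m → ℕ) (ps : List (Fin m → ℕ)) : Set (Fin m → ℕ) :=
  {v | ∃ n : Fin ps.length → ℕ, v = b + ∑ i, n i • ps.get i}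

/-- The entry for a transition in a description. -/
def PTARTransition.code {m k s : ℕ} {rk : Fin s → ℕ} (τ : PTARTransition m (Fin k) rk) :
    ℕ × ℕ × List (ℕ × StorageOp m) :=
  (τ.src, τ.sym, List.ofFn fun i => ((τ.tgt i : ℕ), τ.op i))

/-- `c` is a description of the automaton `A` with states `0, …, k - 1` over the ranked alphabet
with symbols `0, …, s - 1`. -/
structure PTARCode.Describes {m k s : ℕ} {rk : Fin s → ℕ} (c : PTARCode m)
    (A : PTAR m (Fin k) rk) : Prop where
  numStates_eq : c.numStates = k
  ranks_eq : c.ranks = List.ofFn rk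
  init_eq : c.init = A.init
  mem_trans : ∀ x, x ∈ c.trans ↔ ∃ τ ∈ A.trans, τ.code = x
  accept_eq : A.accept = ⋃ p ∈ c.accept, linearSetOf p.1 p.2

/-! The halting problem is reduced to non-emptiness. A symbol of rank 2 copies the counter
configuration into two branches that must both succeed, so a configuration can be tested by a side
branch without being changed. Acceptance is at constant vectors: a vector then encodes a pair of
integers by the differences of its first two coordinates to the others, and a counter is decremented
by raising all other coordinates. This uses the third coordinate as reference, whence `3 ≤ m`.

Structured programs on two integer counters, with such tests, are thus simulated
(`CounterProg.exists_inputPTA`). Tests make it possible to multiply, divide and check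
non-divisibility (`rel_scale`, `rel_testNotDvd`), so a product of prime powers in the first counter
acts as infinitely many registers. With guessing and loops, programs check the graph of every
primitive recursive function (`GraphCheckable.of_primrec`), hence a bounded-step halting predicate
with a guessed bound.

One fixed program serves all inputs. The input enters only through the vector of the first
transition, so the reduction is primitive recursive. -/

/-! ### Non-emptiness as derivability of configurations -/

namespace PTAR

variable {m : ℕ} {Q S : Type*} [Finite Q] [Finite S] {rk : S → ℕ}

/-- `A.Der q w` says that the configuration `(q, w)` can be rewritten into a tree without
configurations. -/
inductive Der (A : PTAR m Q rk) : Q → (Fin m → ℕ) → Prop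
  | intro (τ : PTARTransition m Q rk) (w : Fin m → ℕ) (hτ : τ ∈ A.trans)
      (hw : rk τ.sym = 0 → w ∈ A.accept)
      (h : ∀ i, Der A (τ.tgt i) (StorageOp.apply w (τ.op i))) : Der A τ.src w

/-- All configurations in a tree can be rewritten into trees without configurations. -/
def AllDer (A : PTAR m Q rk) : RTree rk (Q × (Fin m → ℕ)) → Prop
  | .leaf h => A.Der h.1 h.2
  | .node _ c => ∀ i, AllDer A (c i)

theorem allDer_embed (A : PTAR m Q rk) (ξ : RTree rk Empty) : A.AllDer ξ.embed := by
  induction ξ with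
  | leaf h => exact h.elim
  | node σ c ih => exact fun i => ih i

theorem AllDer.of_rewrite {A : PTAR m Q rk} {τ : PTARTransition m Q rk} (hτ : τ ∈ A.trans)
    {ξ₁ ξ₂ : RTree rk (Q × (Fin m → ℕ))} (h : A.Rewrite τ ξ₁ ξ₂) (h₂ : A.AllDer ξ₂) :
    A.AllDer ξ₁ := by
  cases h with
  | inner w h => exact Der.intro τ w hτ (fun h0 => by omega) fun i => h₂ i
  | nullary w h hw c => exact Der.intro τ w hτ (fun _ => hw) fun i => (Fin.cast h i).elim0

theorem AllDer.plug {A : PTAR m Q rk} {ξ₁ ξ₂ : RTree rk (Q × (Fin m → ℕ))}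
    (h : A.AllDer ξ₂ → A.AllDer ξ₁) (ζ : RContext rk (Q × (Fin m → ℕ)))
    (hζ : A.AllDer (ζ.plug ξ₂)) : A.AllDer (ζ.plug ξ₁) := by
  induction ζ with
  | hole => exact h hζ
  | node σ i c ζ ih =>
    intro j
    have hj := hζ j
    by_cases hij : j = i
    · subst hij
      rw [Function.update_self] at hj ⊢
      exact ih hj
    · rw [Function.update_of_ne hij] at hj ⊢
      exact hj

/-- Derivability travels backwards along a computation: the premises of `Der.intro` are what a
rewrite leaves to be done, and the context is untouched. -/
theorem AllDer.of_step {A : PTAR m Q rk} {ζ₁ ζ₂ : RTree rk (Q × (Fin m → ℕ))}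
    (h : A.Step ζ₁ ζ₂) (h₂ : A.AllDer ζ₂) : A.AllDer ζ₁ := by
  obtain ⟨τ, hτ, ζ, ξ₁, ξ₂, rfl, rfl, hr⟩ := h
  exact AllDer.plug (AllDer.of_rewrite hτ hr) ζ h₂

theorem Step.node {A : PTAR m Q rk} {ξ₁ ξ₂ : RTree rk (Q × (Fin m → ℕ))} (h : A.Step ξ₁ ξ₂)
    (σ : S) (c : Fin (rk σ) → RTree rk (Q × (Fin m → ℕ))) (i : Fin (rk σ)) :
    A.Step (.node σ (Function.update c i ξ₁)) (.node σ (Function.update c i ξ₂)) := by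
  obtain ⟨τ, hτ, ζ, η₁, η₂, rfl, rfl, hr⟩ := h
  exact ⟨τ, hτ, .node σ i c ζ, η₁, η₂, rfl, rfl, hr⟩

theorem reflTransGen_node_update {A : PTAR m Q rk} {ξ₁ ξ₂ : RTree rk (Q × (Fin m → ℕ))}
    (h : Relation.ReflTransGen A.Step ξ₁ ξ₂)
    (σ : S) (c : Fin (rk σ) → RTree rk (Q × (Fin m → ℕ))) (i : Fin (rk σ)) :
    Relation.ReflTransGen A.Step (.node σ (Function.update c i ξ₁))
      (.node σ (Function.update c i ξ₂)) :=
  h.lift (fun ξ => RTree.node σ (Function.update c i ξ)) fun _ _ h => Step.node h σ c i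

theorem reflTransGen_node {A : PTAR m Q rk} (σ : S)
    {c c' : Fin (rk σ) → RTree rk (Q × (Fin m → ℕ))}
    (h : ∀ i, Relation.ReflTransGen A.Step (c i) (c' i)) :
    Relation.ReflTransGen A.Step (.node σ c) (.node σ c') := by
  -- The children are rewritten one at a time; `s` is the set of those already done.
  suffices H : ∀ s : Finset (Fin (rk σ)),
      Relation.ReflTransGen A.Step (.node σ c) (.node σ (s.piecewise c' c)) by
    simpa using H Finset.univ
  intro s
  induction s using Finset.induction_on with
  | empty => simpa using Relation.ReflTransGen.refl
  | insert i s his ih =>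
    refine ih.trans ?_
    rw [Finset.piecewise_insert]
    have := reflTransGen_node_update (h i) σ (s.piecewise c' c) i
    rwa [show Function.update (s.piecewise c' c) i (c i) = s.piecewise c' c from by
      rw [Function.update_eq_self_iff, Finset.piecewise_eq_of_notMem _ _ _ his]] at this

theorem Der.exists_tree {A : PTAR m Q rk} {q : Q} {w : Fin m → ℕ} (h : A.Der q w) :
    ∃ ξ : RTree rk Empty, Relation.ReflTransGen A.Step (.leaf (q, w)) ξ.embed := by
  induction h with
  | intro τ w hτ hw _ ih =>
    choose ξ hξ using ih
    refine ⟨.node τ.sym ξ, ?_⟩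
    by_cases h0 : rk τ.sym = 0
    · exact Relation.ReflTransGen.single
        ⟨τ, hτ, .hole, _, _, rfl, rfl, Rewrite.nullary w h0 (hw h0) _⟩
    · exact Relation.ReflTransGen.head
        ⟨τ, hτ, .hole, _, _, rfl, rfl, Rewrite.inner w (Nat.one_le_iff_ne_zero.2 h0)⟩
        (reflTransGen_node τ.sym hξ)

theorem language_nonempty_iff (A : PTAR m Q rk) : A.language.Nonempty ↔ A.Der A.init 0 := by
  constructor
  · rintro ⟨ξ, hξ⟩
    have : A.AllDer (.leaf (A.init, 0)) :=
      Relation.ReflTransGen.head_induction_on (motive := fun ζ _ => A.AllDer ζ) hξ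
        (A.allDer_embed ξ) fun h _ h₂ => AllDer.of_step h h₂
    exact this
  · intro h
    exact h.exists_tree

end PTAR

/-! ### Two-counter programs and their alternating rules -/

/-- Structured programs on two integer counters. -/
inductive CounterProg where
  | shift (d : ℤ × ℤ)
  | test (p : CounterProg)
  | seq (p q : CounterProg)
  | alt (p q : CounterProg)
  | star (p : CounterProg)

namespace CounterProg

/-- The input-output relation of a program. The program `test p` does not change the counters, and
terminates if `p` can bring both counters to `0`. -/
def Rel : CounterProg → ℤ × ℤ → ℤ × ℤ → Prop
  | shift d, v, v' => v' = v + d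
  | test p, v, v' => v' = v ∧ p.Rel v 0
  | seq p q, v, v' => ∃ u, p.Rel v u ∧ q.Rel u v'
  | alt p q, v, v' => p.Rel v v' ∨ q.Rel v v'
  | star p, v, v' => Relation.ReflTransGen p.Rel v v'

/-- The rules of the alternating automaton whose states are lists of programs that remain to be
executed. -/
inductive Rule where
  | accept
  | step (K : List CounterProg) (d : ℤ × ℤ)
  | branch (K L : List CounterProg)

/-- A rule holds at `v` if its conclusion follows at `v` from the judgements `D`. -/
def Rule.Holds (D : List CounterProg → ℤ × ℤ → Prop) (v : ℤ × ℤ) : Rule → Prop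
  | accept => v = 0
  | step K d => D K (v + d)
  | branch K L => D K v ∧ D L v

/-- The states that occur in a rule. -/
def Rule.targets : Rule → Set (List CounterProg)
  | accept => ∅
  | step K _ => {K}
  | branch K L => {K, L}

/-- The rules that start in a given state. -/
def rules : List CounterProg → List Rule
  | [] => [.accept]
  | shift d :: K => [.step K d]
  | test p :: K => [.branch K [p]]
  | seq p q :: K => [.step (p :: q :: K) 0]
  | alt p q :: K => [.step (p :: K) 0, .step (q :: K) 0]
  | star p :: K => [.step K 0, .step (p :: star p :: K) 0]

/-- Executing the programs of a list one after the other can bring both counters to `0`. -/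
def Accepts : List CounterProg → ℤ × ℤ → Prop
  | [], v => v = 0
  | p :: K, v => ∃ v', p.Rel v v' ∧ Accepts K v'

theorem accepts_singleton {p : CounterProg} {v : ℤ × ℤ} : Accepts [p] v ↔ p.Rel v 0 := by
  simp [Accepts]

theorem accepts_of_holds {K : List CounterProg} {r : Rule} (hr : r ∈ rules K) {v : ℤ × ℤ}
    (h : r.Holds Accepts v) : Accepts K v := by
  rcases K with _ | ⟨_ | p | ⟨p, q⟩ | ⟨p, q⟩ | p, K⟩ <;>
    simp only [rules, List.mem_cons, List.not_mem_nil, or_false] at hr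
  · subst hr; exact h
  · subst hr; exact ⟨_, rfl, h⟩
  · subst hr; exact ⟨v, ⟨rfl, accepts_singleton.1 h.2⟩, h.1⟩
  · subst hr
    simp only [Rule.Holds, add_zero] at h
    obtain ⟨u, hu, v', hv', h⟩ := h
    exact ⟨v', ⟨u, hu, hv'⟩, h⟩
  · rcases hr with rfl | rfl <;> simp only [Rule.Holds, add_zero] at h <;>
      obtain ⟨v', hv', h⟩ := h
    · exact ⟨v', Or.inl hv', h⟩
    · exact ⟨v', Or.inr hv', h⟩
  · rcases hr with rfl | rfl <;> simp only [Rule.Holds, add_zero] at h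
    · exact ⟨v, Relation.ReflTransGen.refl, h⟩
    · obtain ⟨u, hu, v', hv', h⟩ := h
      exact ⟨v', Relation.ReflTransGen.head hu hv', h⟩

/-- The states that are reachable from `p :: K` before `K` is reached. -/
def support : CounterProg → List CounterProg → Set (List CounterProg)
  | shift d, K => {shift d :: K}
  | test p, K => insert (test p :: K) (p.support [])
  | seq p q, K => insert (seq p q :: K) (p.support (q :: K) ∪ q.support K)
  | alt p q, K => insert (alt p q :: K) (p.support K ∪ q.support K)
  | star p, K => insert (star p :: K) (p.support (star p :: K))

theorem cons_mem_support (p : CounterProg) (K : List CounterProg) : p :: K ∈ p.support K := by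
  cases p <;> simp [support]

/-- The recursion is on the program alone. A loop body gets `star p :: K` as continuation and so
returns to a state already counted; this is why finitely many states suffice. -/
theorem support_finite (p : CounterProg) (K : List CounterProg) : (p.support K).Finite := by
  induction p generalizing K with
  | shift d => exact Set.finite_singleton _
  | test p ih => exact (ih _).insert _
  | seq p q ihp ihq => exact ((ihp _).union (ihq _)).insert _
  | alt p q ihp ihq => exact ((ihp _).union (ihq _)).insert _
  | star p ih => exact (ih _).insert _

/-- The set `S` stays fixed while the induction passes to subprograms with other continuations. The
empty list is required because a test starts a side branch with nothing after it. -/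
theorem targets_subset_support (p : CounterProg) (K : List CounterProg) {S : Set _}
    (hS : p.support K ⊆ S) (hK : K ∈ S) (h0 : [] ∈ S) {L : List CounterProg}
    (hL : L ∈ p.support K) {r : Rule} (hr : r ∈ rules L) : r.targets ⊆ S := by
  induction p generalizing K with
  | shift d =>
    rw [support, Set.mem_singleton_iff] at hL
    subst hL
    simp only [rules, List.mem_singleton] at hr
    subst hr
    simpa [Rule.targets] using hK
  | test p ih =>
    rw [support, Set.insert_subset_iff] at hS
    rcases hL with rfl | hL
    · simp only [rules, List.mem_singleton] at hr
      subst hr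
      simpa [Rule.targets, Set.insert_subset_iff, hK] using hS.2 (cons_mem_support p [])
    · exact ih _ hS.2 h0 hL
  | seq p q ihp ihq =>
    rw [support, Set.insert_subset_iff, Set.union_subset_iff] at hS
    rcases hL with rfl | hL | hL
    · simp only [rules, List.mem_singleton] at hr
      subst hr
      simpa [Rule.targets] using hS.2.1 (cons_mem_support p (q :: K))
    · exact ihp _ hS.2.1 (hS.2.2 (cons_mem_support q K)) hL
    · exact ihq _ hS.2.2 hK hL
  | alt p q ihp ihq =>
    rw [support, Set.insert_subset_iff, Set.union_subset_iff] at hS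
    rcases hL with rfl | hL | hL
    · simp only [rules, List.mem_cons, List.not_mem_nil, or_false] at hr
      rcases hr with rfl | rfl
      · simpa [Rule.targets] using hS.2.1 (cons_mem_support p K)
      · simpa [Rule.targets] using hS.2.2 (cons_mem_support q K)
    · exact ihp _ hS.2.1 hK hL
    · exact ihq _ hS.2.2 hK hL
  | star p ih =>
    rw [support, Set.insert_subset_iff] at hS
    rcases hL with rfl | hL
    · simp only [rules, List.mem_cons, List.not_mem_nil, or_false] at hr
      rcases hr with rfl | rfl
      · simpa [Rule.targets] using hK
      · simpa [Rule.targets] using hS.2 (cons_mem_support p _)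
    · exact ih _ hS.2 hS.1 hL

/-- Completeness of the rules in continuation-passing form: a run of `p` pulls a judgement about `K`
back to one about `p :: K`. Closure of `D` is asked only on `S`, as only those lists become states.
-/
theorem judgement_of_rel {S : Set (List CounterProg)} {D : List CounterProg → ℤ × ℤ → Prop}
    (hD : ∀ K ∈ S, ∀ r ∈ rules K, ∀ v, r.Holds D v → D K v) (h0 : [] ∈ S) (p : CounterProg)
    (K : List CounterProg) (hS : p.support K ⊆ S) {v v' : ℤ × ℤ} (h : p.Rel v v')
    (hv' : D K v') : D (p :: K) v := by
  have hp := hS (cons_mem_support p K)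
  induction p generalizing K v v' with
  | shift d =>
    rw [Rel] at h
    subst h
    exact hD _ hp (.step K d) (by simp [rules]) v hv'
  | test p ih =>
    obtain ⟨rfl, h⟩ := h
    rw [support, Set.insert_subset_iff] at hS
    exact hD _ hp (.branch K [p]) (by simp [rules]) v'
      ⟨hv', ih _ hS.2 h (hD [] h0 .accept (by simp [rules]) 0 rfl) (hS.2 (cons_mem_support p _))⟩
  | seq p q ihp ihq =>
    obtain ⟨u, hu, h⟩ := h
    rw [support, Set.insert_subset_iff, Set.union_subset_iff] at hS
    refine hD _ hp (.step (p :: q :: K) 0) (by simp [rules]) v ?_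
    rw [Rule.Holds, add_zero]
    exact ihp _ hS.2.1 hu (ihq _ hS.2.2 h hv' (hS.2.2 (cons_mem_support q _)))
      (hS.2.1 (cons_mem_support p _))
  | alt p q ihp ihq =>
    rw [support, Set.insert_subset_iff, Set.union_subset_iff] at hS
    rcases h with h | h
    · refine hD _ hp (.step (p :: K) 0) (by simp [rules]) v ?_
      rw [Rule.Holds, add_zero]
      exact ihp _ hS.2.1 h hv' (hS.2.1 (cons_mem_support p _))
    · refine hD _ hp (.step (q :: K) 0) (by simp [rules]) v ?_
      rw [Rule.Holds, add_zero]
      exact ihq _ hS.2.2 h hv' (hS.2.2 (cons_mem_support q _))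
  | star p ih =>
    rw [support, Set.insert_subset_iff] at hS
    refine Relation.ReflTransGen.head_induction_on (motive := fun u _ => D (star p :: K) u) h ?_ ?_
    · refine hD _ hp (.step K 0) (by simp [rules]) v' ?_
      rwa [Rule.Holds, add_zero]
    · intro u u' hu _ hu'
      refine hD _ hp (.step (p :: star p :: K) 0) (by simp [rules]) u ?_
      rw [Rule.Holds, add_zero]
      exact ih _ hS.2 hu hu' (hS.2 (cons_mem_support p _))

end CounterProg

/-! ### Simulation of programs by Parikh tree automata -/

/-- The coordinates of the vector `(v.1, v.2, 0, …, 0)`. -/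
def padPair {m : ℕ} (v : ℤ × ℤ) (i : Fin m) : ℤ :=
  if i.1 = 0 then v.1 else if i.1 = 1 then v.2 else 0

theorem padPair_add {m : ℕ} (v v' : ℤ × ℤ) (i : Fin m) :
    padPair (v + v') i = padPair v i + padPair v' i := by
  unfold padPair
  split_ifs <;> simp

/-- A vector of natural numbers represents a pair of integers if it differs from the padded pair
by a constant vector. -/
def Represents {m : ℕ} (w : Fin m → ℕ) (v : ℤ × ℤ) : Prop :=
  ∃ c : ℤ, ∀ i, (w i : ℤ) = c + padPair v i

/-- A vector of natural numbers that represents the pair `d`. -/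
def representative (m : ℕ) (d : ℤ × ℤ) (i : Fin m) : ℕ :=
  (|d.1| + |d.2| + padPair d i).toNat

theorem represents_representative (m : ℕ) (d : ℤ × ℤ) : Represents (representative m d) d := by
  -- This offset makes every coordinate nonnegative, so `toNat` loses nothing.
  refine ⟨|d.1| + |d.2|, fun i => Int.toNat_of_nonneg ?_⟩
  have h1 := neg_abs_le d.1
  have h2 := neg_abs_le d.2
  have h3 := abs_nonneg d.1
  have h4 := abs_nonneg d.2
  unfold padPair
  split_ifs <;> linarith

theorem Represents.add {m : ℕ} {w w' : Fin m → ℕ} {v v' : ℤ × ℤ} (h : Represents w v)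
    (h' : Represents w' v') : Represents (w + w') (v + v') := by
  obtain ⟨c, hc⟩ := h
  obtain ⟨c', hc'⟩ := h'
  refine ⟨c + c', fun i => ?_⟩
  rw [padPair_add, Pi.add_apply, Nat.cast_add, hc, hc']
  ring

/-- Coordinate `2` equals the unknown offset, so coordinates `0` and `1` agree with it exactly when
both counters vanish. -/
theorem Represents.eq_zero_iff {m : ℕ} (hm : 3 ≤ m) {w : Fin m → ℕ} {v : ℤ × ℤ}
    (h : Represents w v) : v = 0 ↔ ∃ n : ℕ, ∀ i, w i = n := by
  obtain ⟨c, hc⟩ := h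
  constructor
  · rintro rfl
    have h0 : ∀ i, (w i : ℤ) = c := fun i => by simpa [padPair] using hc i
    exact ⟨w ⟨0, by omega⟩, fun i => by exact_mod_cast (h0 i).trans (h0 _).symm⟩
  · rintro ⟨n, hn⟩
    have h0 := hc ⟨0, by omega⟩
    have h1 := hc ⟨1, by omega⟩
    have h2 := hc ⟨2, by omega⟩
    simp only [hn, padPair] at h0 h1 h2
    norm_num at h0 h1 h2
    ext <;> simp <;> omega

namespace CounterProg

/-- The transition of a Parikh tree automaton that carries out a rule. There is one symbol of each
of the ranks `0`, `1` and `2`. -/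
def Rule.transition (m : ℕ) {k : ℕ} (q : Fin k) (idx : List CounterProg → Fin k) :
    Rule → PTARTransition m (Fin k) (fun σ : Fin 3 => (σ : ℕ))
  | accept => ⟨q, 0, fun _ => q, fun _ => some 0⟩
  | step K d => ⟨q, 1, fun _ => idx K, fun _ => some (representative m d)⟩
  | branch K L => ⟨q, 2, fun i => if i.1 = 0 then idx K else idx L, fun _ => some 0⟩

end CounterProg

/-- The vector `(n, 0, …, 0)`. -/
def inputVector (m n : ℕ) (i : Fin m) : ℕ := if i.1 = 0 then n else 0

theorem represents_inputVector (m n : ℕ) : Represents (inputVector m n) (n, 0) :=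
  ⟨0, fun i => by unfold inputVector padPair; split_ifs <;> simp⟩

/-- The transition from the state `0` to the state `q` that adds the vector `(n, 0, …, 0)`. -/
def inputTransition (m : ℕ) {k : ℕ} (q : Fin (k + 1)) (n : ℕ) :
    PTARTransition m (Fin (k + 1)) (fun σ : Fin 3 => (σ : ℕ)) :=
  ⟨0, 1, fun _ => q, fun _ => some (inputVector m n)⟩

/-- The automaton with given transitions that accepts at constant vectors, and that first adds the
vector `(n, 0, …, 0)` and goes to the state `q`. -/
def inputPTA (m : ℕ) {k : ℕ} (T : List (PTARTransition m (Fin (k + 1)) (fun σ : Fin 3 => (σ : ℕ))))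
    (q : Fin (k + 1)) (n : ℕ) : PTAR m (Fin (k + 1)) (fun σ : Fin 3 => (σ : ℕ)) where
  init := 0
  trans := {τ | τ ∈ inputTransition m q n :: T}
  trans_finite := List.finite_toSet _
  accept := {w | ∃ n : ℕ, ∀ i, w i = n}
  accept_semilinear := by
    have : {w : Fin m → ℕ | ∃ n : ℕ, ∀ i, w i = n} =
        (AddSubmonoid.closure (({1} : Finset (Fin m → ℕ)) : Set (Fin m → ℕ)) :
          Set (Fin m → ℕ)) := by
      ext w
      rw [Finset.coe_singleton, SetLike.mem_coe, AddSubmonoid.mem_closure_singleton]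
      simp [funext_iff, eq_comm]
    rw [this]
    exact (IsLinearSet.closure_finset _).isSemilinearSet

namespace CounterProg

variable {m k : ℕ}

/-- The transitions for the rules that start in the states `f 0, f 1, …`. -/
def transitions (m : ℕ) (f : Fin k → List CounterProg) (idx : List CounterProg → Fin k) :
    List (PTARTransition m (Fin (k + 1)) (fun σ : Fin 3 => (σ : ℕ))) :=
  (List.finRange k).flatMap fun i =>
    -- State `0` is kept for the initial state, hence the shift by `succ`.
    (rules (f i)).map (Rule.transition m i.succ fun K => (idx K).succ)

theorem mem_transitions {f : Fin k → List CounterProg} {idx : List CounterProg → Fin k}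
    {τ : PTARTransition m (Fin (k + 1)) (fun σ : Fin 3 => (σ : ℕ))} :
    τ ∈ transitions m f idx ↔
      ∃ i, ∃ r ∈ rules (f i), r.transition m i.succ (fun K => (idx K).succ) = τ := by
  simp [transitions]

theorem transitions_op_ne_none {f : Fin k → List CounterProg} {idx : List CounterProg → Fin k}
    {τ : PTARTransition m (Fin (k + 1)) (fun σ : Fin 3 => (σ : ℕ))}
    (h : τ ∈ transitions m f idx) (i : Fin τ.sym) : τ.op i ≠ none := by
  obtain ⟨_, r, _, rfl⟩ := mem_transitions.1 h
  cases r <;> simp [Rule.transition]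

theorem accepts_of_der (hm : 3 ≤ m) {f : Fin k → List CounterProg}
    {idx : List CounterProg → Fin k}
    (hf : ∀ i, ∀ r ∈ rules (f i), ∀ K ∈ r.targets, f (idx K) = K) {q : Fin (k + 1)} {n : ℕ}
    {q' : Fin (k + 1)} {w : Fin m → ℕ} (h : (inputPTA m (transitions m f idx) q n).Der q' w)
    (i : Fin k) (hi : q' = i.succ) (v : ℤ × ℤ) (hw : Represents w v) : Accepts (f i) v := by
  induction h generalizing i v with
  | intro τ w hτ hacc _ ih =>
    rcases List.mem_cons.1 hτ with rfl | hτ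
    · exact absurd hi (Fin.succ_ne_zero i).symm
    · obtain ⟨j, r, hr, rfl⟩ := mem_transitions.1 hτ
      have hji : j = i := by
        cases r <;> exact Fin.succ_injective _ hi
      subst hji
      refine accepts_of_holds hr ?_
      have hr' := hf j r hr
      cases r with
      | accept => exact (hw.eq_zero_iff hm).2 (hacc rfl)
      | step K d =>
        have := ih ⟨0, Nat.one_pos⟩ (idx K) rfl (v + d) (hw.add (represents_representative m d))
        rwa [hr' K rfl] at this
      | branch K L =>
        have h1 := ih ⟨0, Nat.two_pos⟩ (idx K) rfl v hw
        have h2 := ih ⟨1, Nat.one_lt_two⟩ (idx L) rfl v hw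
        rw [hr' K (Or.inl rfl)] at h1
        rw [hr' L (Or.inr rfl)] at h2
        exact ⟨h1, h2⟩

/-- The judgement quantifies over all representatives `w`, because `v` does not determine the
offset, which grows along a run. -/
theorem der_of_holds (hm : 3 ≤ m) {f : Fin k → List CounterProg}
    {idx : List CounterProg → Fin k} {q : Fin (k + 1)} {n : ℕ} {i : Fin k} {r : Rule}
    (hr : r ∈ rules (f i)) {v : ℤ × ℤ}
    (h : r.Holds (fun K v => ∀ w, Represents w v →
      (inputPTA m (transitions m f idx) q n).Der (idx K).succ w) v)
    {w : Fin m → ℕ} (hw : Represents w v) :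
    (inputPTA m (transitions m f idx) q n).Der i.succ w := by
  have hmem : r.transition m i.succ (fun K => (idx K).succ) ∈
      (inputPTA m (transitions m f idx) q n).trans :=
    List.mem_cons_of_mem _ (mem_transitions.2 ⟨i, r, hr, rfl⟩)
  cases r with
  | accept =>
    exact PTAR.Der.intro _ w hmem (fun _ => (hw.eq_zero_iff hm).1 h) fun j => Fin.elim0 j
  | step K d =>
    exact PTAR.Der.intro _ w hmem (fun h0 => absurd h0 Nat.one_ne_zero) fun _ =>
      h _ (hw.add (represents_representative m d))
  | branch K L =>
    refine PTAR.Der.intro _ w hmem (fun h0 => absurd h0 two_ne_zero) fun j => ?_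
    change (inputPTA m (transitions m f idx) q n).Der
      (if j.1 = 0 then (idx K).succ else (idx L).succ) (w + 0)
    rw [add_zero]
    split_ifs
    · exact h.1 w hw
    · exact h.2 w hw

/-- Programs can be simulated by Parikh tree automata of dimension at least `3`. -/
theorem exists_inputPTA (hm : 3 ≤ m) (p : CounterProg) :
    ∃ (k : ℕ) (T : List (PTARTransition m (Fin (k + 1)) (fun σ : Fin 3 => (σ : ℕ))))
      (q : Fin (k + 1)), (∀ τ ∈ T, ∀ i, τ.op i ≠ none) ∧
        ∀ n : ℕ, (inputPTA m T q n).language.Nonempty ↔ p.Rel (n, 0) 0 := by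
  obtain ⟨k, f, -, hf⟩ := ((p.support_finite []).insert []).fin_param
  have h0 : [] ∈ Set.range f := hf ▸ Set.mem_insert _ _
  have hS : p.support [] ⊆ Set.range f := hf ▸ Set.subset_insert _ _
  have : ∃ idx : List CounterProg → Fin k, ∀ K ∈ Set.range f, f (idx K) = K := by
    have (K : List CounterProg) : ∃ i, K ∈ Set.range f → f i = K := by
      by_cases hK : K ∈ Set.range f
      · exact hK.imp fun i hi _ => hi
      -- Lists that are not states get the index of `[]`, a default that is never used.
      · exact h0.imp fun i _ h => absurd h hK
    exact Classical.skolem.1 this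
  obtain ⟨idx, hidx⟩ := this
  refine ⟨k, transitions m f idx, (idx [p]).succ, fun τ hτ => transitions_op_ne_none hτ,
    fun n => ?_⟩
  have hp := hidx _ (hS (cons_mem_support p []))
  have hcl : ∀ i, ∀ r ∈ rules (f i), ∀ K ∈ r.targets, f (idx K) = K := by
    intro i r hr K hK
    have hi : f i ∈ insert [] (p.support []) := hf ▸ Set.mem_range_self i
    rcases hi with hi | hi
    · rw [hi, rules, List.mem_singleton] at hr
      subst hr
      exact hK.elim
    · exact hidx K (targets_subset_support p [] hS h0 h0 hi hr hK)
  rw [PTAR.language_nonempty_iff, ← accepts_singleton]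
  constructor
  · intro h
    -- State and vector become variables so that the derivation can be inverted; only the input
    -- transition leaves state `0`.
    suffices H : ∀ q w, (inputPTA m (transitions m f idx) (idx [p]).succ n).Der q w → q = 0 →
        w = 0 → Accepts [p] (n, 0) from H _ _ h rfl rfl
    rintro _ _ ⟨τ, w, hτ, -, h⟩ hq rfl
    rcases List.mem_cons.1 hτ with rfl | hτ
    · have h1 := h ⟨0, Nat.one_pos⟩
      rw [← hp]
      refine accepts_of_der hm hcl h1 (idx [p]) rfl _ ?_
      change Represents (0 + inputVector m n) _
      rw [zero_add]
      exact represents_inputVector m n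
    · obtain ⟨j, r, -, rfl⟩ := mem_transitions.1 hτ
      cases r <;> exact absurd hq (Fin.succ_ne_zero j)
  · intro h
    refine PTAR.Der.intro (inputTransition m (idx [p]).succ n) 0 List.mem_cons_self
      (fun h0 => absurd h0 Nat.one_ne_zero) fun _ => ?_
    have hD := judgement_of_rel (S := Set.range f)
      (D := fun K v => ∀ w, Represents w v →
        (inputPTA m (transitions m f idx) (idx [p]).succ n).Der (idx K).succ w)
      (fun K hK r hr v h w hw => der_of_holds hm (i := idx K) (by rwa [hidx K hK]) h hw)
      h0 p [] hS (accepts_singleton.1 h)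
      (fun w hw => der_of_holds hm (i := idx []) (r := .accept) (by simp [hidx _ h0, rules]) rfl hw)
    refine hD _ ?_
    change Represents (0 + inputVector m n) _
    rw [zero_add]
    exact represents_inputVector m n

end CounterProg

/-! ### Multiplication and divisibility by programs -/

namespace CounterProg

theorem rel_star_shift {d v v' : ℤ × ℤ} :
    (star (shift d)).Rel v v' ↔ ∃ n : ℕ, v' = v + n • d := by
  constructor
  · intro h
    induction h with
    | refl => exact ⟨0, by simp⟩
    | tail _ h ih =>
      obtain ⟨n, rfl⟩ := ih
      rw [Rel] at h
      exact ⟨n + 1, by rw [h, add_assoc, succ_nsmul]⟩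
  · rintro ⟨n, rfl⟩
    induction n with
    | zero => rw [zero_nsmul, add_zero]; exact Relation.ReflTransGen.refl
    | succ n ih => exact Relation.ReflTransGen.tail ih (by rw [Rel, add_assoc, succ_nsmul])

/-- From `(a * k, 0)` to `(b * k, 0)`. -/
def scale (a b : ℕ) : CounterProg :=
  seq (star (shift (-a, b))) (seq (test (star (shift (0, -1))))
    (seq (star (shift (1, -1))) (test (star (shift (-1, 0))))))

/-- Each test lets only one counter decrease, so it forces the other to be `0` and this one to be
nonnegative. The first test certifies that `N` was used up exactly, the second that all was moved
back. -/
theorem rel_scale {a b N : ℕ} {v : ℤ × ℤ} :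
    (scale a b).Rel (N, 0) v ↔ ∃ k : ℕ, N = a * k ∧ v = (((b * k : ℕ) : ℤ), (0 : ℤ)) := by
  simp only [scale, Rel.eq_3, Rel.eq_2, rel_star_shift]
  constructor
  · rintro ⟨_, ⟨k, rfl⟩, _, ⟨rfl, i, hi⟩, _, ⟨j, rfl⟩, rfl, l, hl⟩
    simp [Prod.ext_iff] at hi hl ⊢
    refine ⟨k, ?_, ?_⟩
    · zify; linarith [hi.1]
    · constructor <;> linarith [hi.1, hi.2, hl.1, hl.2]
  · rintro ⟨k, rfl, rfl⟩
    refine ⟨_, ⟨k, rfl⟩, _, ⟨rfl, b * k, ?_⟩, _, ⟨b * k, rfl⟩, ?_, b * k, ?_⟩ <;>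
      simp [Prod.ext_iff] <;> ring_nf <;> simp

/-- Check that `p` does not divide the first counter. -/
def testNotDvd (p : ℕ) : CounterProg :=
  test (seq (star (shift (-p, 0))) (seq (shift (-1, 0)) (seq (test (star (shift (-1, 0))))
    (seq (shift (2 - p, 0)) (star (shift (1, 0)))))))

/-- After `k` subtractions of `p`, the inner test says that at least `1` is left, and the final
increments to `0` say that at most `p - 1` is left. -/
theorem rel_testNotDvd {p N : ℕ} (hp : 2 ≤ p) {v : ℤ × ℤ} :
    (testNotDvd p).Rel (N, 0) v ↔ v = ((N : ℤ), (0 : ℤ)) ∧ ¬ p ∣ N := by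
  simp only [testNotDvd, Rel.eq_3, Rel.eq_2, Rel.eq_1, rel_star_shift]
  refine and_congr_right fun _ => ?_
  constructor
  · rintro ⟨_, ⟨k, rfl⟩, _, rfl, _, ⟨rfl, i, hi⟩, _, rfl, j, hj⟩ ⟨c, rfl⟩
    simp [Prod.ext_iff] at hi hj
    have h1 : (0 : ℤ) < p * (c - k) := by linarith
    have h2 : (p : ℤ) * (c - k) < p * 1 := by linarith
    have h3 := pos_of_mul_pos_right h1 (by positivity)
    have h4 := lt_of_mul_lt_mul_left h2 (by positivity)
    omega
  · intro h
    have h1 : N % p ≠ 0 := fun h0 => h (Nat.dvd_of_mod_eq_zero h0)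
    have h2 := Nat.mod_lt N (show p > 0 by omega)
    have h3 := Nat.div_add_mod N p
    refine ⟨_, ⟨N / p, rfl⟩, _, rfl, _, ⟨rfl, N % p - 1, ?_⟩, _, rfl, p - 1 - N % p, ?_⟩ <;>
      simp only [Prod.ext_iff, Prod.fst_add, Prod.snd_add, Prod.smul_mk, Prod.fst_zero,
        Prod.snd_zero, nsmul_eq_mul] <;> zify at h3 <;>
      push_cast [show 1 ≤ N % p by omega, show N % p ≤ p - 1 by omega, show 1 ≤ p by omega] <;>
      constructor <;> linarith

end CounterProg

/-! ### Registers as exponents of primes -/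

/-- The number that represents the contents of infinitely many registers. -/
noncomputable def registerCode (x : ℕ →₀ ℕ) : ℕ := x.prod fun i a => Nat.nth Nat.Prime i ^ a

theorem registerCode_add_single (x : ℕ →₀ ℕ) (i : ℕ) :
    registerCode (x + Finsupp.single i 1) = Nat.nth Nat.Prime i * registerCode x := by
  unfold registerCode
  rw [Finsupp.prod_add_index' (by simp) (by simp [pow_add]), Finsupp.prod_single_index (by simp)]
  ring

theorem registerCode_single (i n : ℕ) :
    registerCode (Finsupp.single i n) = Nat.nth Nat.Prime i ^ n := by
  unfold registerCode
  rw [Finsupp.prod_single_index (by simp)]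

theorem nth_prime_dvd_registerCode (x : ℕ →₀ ℕ) (i : ℕ) :
    Nat.nth Nat.Prime i ∣ registerCode x ↔ x i ≠ 0 := by
  have hi := Nat.prime_nth_prime i
  rw [registerCode, Finsupp.prod, hi.prime.dvd_finsetProd_iff]
  constructor
  · rintro ⟨j, hj, h⟩
    have := (Nat.prime_dvd_prime_iff_eq hi (Nat.prime_nth_prime j)).1 (hi.dvd_of_dvd_pow h)
    rw [Nat.nth_injective Nat.infinite_setOfPred_prime this]
    exact Finsupp.mem_support_iff.1 hj
  · intro h
    exact ⟨i, Finsupp.mem_support_iff.2 h, dvd_pow_self _ h⟩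

theorem Finsupp.exists_eq_add_single {x : ℕ →₀ ℕ} {i : ℕ} (h : x i ≠ 0) :
    ∃ y : ℕ →₀ ℕ, x = y + Finsupp.single i 1 :=
  ⟨x - Finsupp.single i 1, (tsub_add_cancel_of_le (by
    rw [Finsupp.single_le_iff]; omega)).symm⟩

/-- Relations between register contents that can be carried out by programs. -/
def Executable (R : (ℕ →₀ ℕ) → (ℕ →₀ ℕ) → Prop) : Prop :=
  ∃ p : CounterProg, ∀ x v, p.Rel (registerCode x, 0) v ↔ ∃ y, R x y ∧ v = ((registerCode y : ℤ), (0 : ℤ))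

/-- Sets of register contents that can be checked by programs. -/
def Checkable (P : (ℕ →₀ ℕ) → Prop) : Prop :=
  ∃ p : CounterProg, ∀ x, p.Rel (registerCode x, 0) 0 ↔ P x

theorem Checkable.of_iff {P P' : (ℕ →₀ ℕ) → Prop} (h : Checkable P) (hP : ∀ x, P' x ↔ P x) :
    Checkable P' := by
  rwa [show P' = P from funext fun x => propext (hP x)]

namespace Executable

variable {R S : (ℕ →₀ ℕ) → (ℕ →₀ ℕ) → Prop} {P : (ℕ →₀ ℕ) → Prop}

theorem of_iff (h : Executable R) (hR : ∀ x y, S x y ↔ R x y) : Executable S := by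
  rwa [show S = R from funext fun x => funext fun y => propext (hR x y)]

/-- Every result is a natural number in the first counter with `0` in the second, so it can be
counted down. -/
theorem dom (h : Executable R) : Checkable fun x => ∃ y, R x y := by
  obtain ⟨p, hp⟩ := h
  refine ⟨.seq p (.star (.shift (-1, 0))), fun x => ?_⟩
  simp only [CounterProg.Rel.eq_3, hp, CounterProg.rel_star_shift]
  constructor
  · rintro ⟨_, ⟨y, hy, -⟩, -⟩
    exact ⟨y, hy⟩
  · rintro ⟨y, hy⟩
    exact ⟨_, ⟨y, hy, rfl⟩, registerCode y, by simp [Prod.ext_iff]⟩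

theorem test (h : Checkable P) : Executable fun x y => y = x ∧ P x := by
  obtain ⟨p, hp⟩ := h
  refine ⟨.test p, fun x v => ?_⟩
  simp only [CounterProg.Rel.eq_2, hp]
  constructor
  · rintro ⟨rfl, h⟩
    exact ⟨x, ⟨rfl, h⟩, rfl⟩
  · rintro ⟨y, ⟨rfl, h⟩, rfl⟩
    exact ⟨rfl, h⟩

theorem seq (hR : Executable R) (hS : Executable S) :
    Executable fun x z => ∃ y, R x y ∧ S y z := by
  obtain ⟨p, hp⟩ := hR
  obtain ⟨q, hq⟩ := hS
  refine ⟨.seq p q, fun x v => ?_⟩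
  simp only [CounterProg.Rel.eq_3, hp]
  constructor
  · rintro ⟨_, ⟨y, hy, rfl⟩, h⟩
    obtain ⟨z, hz, rfl⟩ := (hq y v).1 h
    exact ⟨z, ⟨y, hy, hz⟩, rfl⟩
  · rintro ⟨z, ⟨y, hy, hz⟩, rfl⟩
    exact ⟨_, ⟨y, hy, rfl⟩, (hq y _).2 ⟨z, hz, rfl⟩⟩

theorem alt (hR : Executable R) (hS : Executable S) : Executable fun x y => R x y ∨ S x y := by
  obtain ⟨p, hp⟩ := hR
  obtain ⟨q, hq⟩ := hS
  refine ⟨.alt p q, fun x v => ?_⟩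
  simp only [CounterProg.Rel.eq_4, hp, hq, or_and_right, exists_or]

theorem star (hR : Executable R) : Executable (Relation.ReflTransGen R) := by
  obtain ⟨p, hp⟩ := hR
  refine ⟨.star p, fun x v => ?_⟩
  simp only [CounterProg.Rel.eq_5]
  constructor
  · intro h
    induction h with
    | refl => exact ⟨x, .refl, rfl⟩
    | tail _ h ih =>
      obtain ⟨y, hy, rfl⟩ := ih
      obtain ⟨z, hz, rfl⟩ := (hp y _).1 h
      exact ⟨z, hy.tail hz, rfl⟩
  · rintro ⟨y, hy, rfl⟩
    exact hy.lift (fun x => ((registerCode x : ℤ), (0 : ℤ))) fun a b h => (hp a _).2 ⟨b, h, rfl⟩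

theorem inc (i : ℕ) : Executable fun x y => y = x + Finsupp.single i 1 := by
  refine ⟨.scale 1 (Nat.nth Nat.Prime i), fun x v => ?_⟩
  simp [CounterProg.rel_scale, registerCode_add_single]

theorem dec (i : ℕ) : Executable fun x y => x = y + Finsupp.single i 1 := by
  refine ⟨.scale (Nat.nth Nat.Prime i) 1, fun x v => ?_⟩
  simp only [CounterProg.rel_scale, one_mul]
  have hi := (Nat.prime_nth_prime i).pos
  constructor
  · rintro ⟨k, hk, rfl⟩
    obtain ⟨y, rfl⟩ := Finsupp.exists_eq_add_single
      ((nth_prime_dvd_registerCode x i).1 (hk ▸ dvd_mul_right _ _))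
    rw [registerCode_add_single] at hk
    exact ⟨y, rfl, by rw [Nat.eq_of_mul_eq_mul_left hi hk]⟩
  · rintro ⟨y, rfl, rfl⟩
    exact ⟨_, registerCode_add_single y i, rfl⟩

/-- Arbitrary increments and decrements of register `i` guess its value. The step relation is
symmetric, so it is enough to reach every value from `0`. -/
theorem havoc (i : ℕ) : Executable fun x y => ∃ a, y = x.update i a := by
  refine ((inc i).alt (dec i)).star.of_iff fun x y => ?_
  set T : (ℕ →₀ ℕ) → (ℕ →₀ ℕ) → Prop :=
    fun x y => y = x + Finsupp.single i 1 ∨ x = y + Finsupp.single i 1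
  have hsymm : Std.Symm T := ⟨fun x y h => h.symm⟩
  constructor
  · rintro ⟨a, rfl⟩
    have H (a : ℕ) : Relation.ReflTransGen T (x.update i 0) (x.update i a) := by
      induction a with
      | zero => exact .refl
      | succ a ih =>
        refine ih.tail (Or.inl ?_)
        ext j
        by_cases hj : j = i
        · subst hj; simp
        · simp [hj]
    have h := H (x i)
    rw [show x.update i (x i) = x from Finsupp.update_self x i] at h
    exact (Relation.ReflTransGen.stdSymm.symm _ _ h).trans (H a)
  · intro h
    induction h with
    | refl => exact ⟨x i, (Finsupp.update_self x i).symm⟩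
    | @tail y z _ h ih =>
      obtain ⟨a, rfl⟩ := ih
      refine ⟨z i, ?_⟩
      ext j
      rcases h with rfl | h
      · by_cases hj : j = i
        · subst hj; simp
        · simp [hj]
      · have h' := DFunLike.congr_fun h j
        by_cases hj : j = i
        · subst hj; simp
        · simpa [hj, Finsupp.single_apply, Ne.symm hj, eq_comm] using h'

end Executable

namespace Checkable

variable {R : (ℕ →₀ ℕ) → (ℕ →₀ ℕ) → Prop} {P P' : (ℕ →₀ ℕ) → Prop}

theorem comp (hR : Executable R) (hP : Checkable P) : Checkable fun x => ∃ y, R x y ∧ P y :=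
  (hR.seq (.test hP)).dom.of_iff fun _ =>
    ⟨fun ⟨y, hy, h⟩ => ⟨y, y, hy, rfl, h⟩, fun ⟨_, y, hy, _, h⟩ => ⟨y, hy, h⟩⟩

theorem and (hP : Checkable P) (hP' : Checkable P') : Checkable fun x => P x ∧ P' x :=
  (comp (.test hP) hP').of_iff fun x =>
    ⟨fun h => ⟨x, ⟨rfl, h.1⟩, h.2⟩, fun ⟨_, ⟨h0, h⟩, h'⟩ => ⟨h, h0 ▸ h'⟩⟩

theorem exists_update (i : ℕ) (hP : Checkable P) : Checkable fun x => ∃ a, P (x.update i a) :=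
  (comp (.havoc i) hP).of_iff fun _ =>
    ⟨fun ⟨a, h⟩ => ⟨_, ⟨a, rfl⟩, h⟩, fun ⟨_, ⟨a, h0⟩, h⟩ => ⟨a, h0 ▸ h⟩⟩

theorem true : Checkable fun _ => True :=
  (Executable.inc 0).dom.of_iff fun x => by simp

theorem eq_zero (i : ℕ) : Checkable fun x => x i = 0 := by
  refine ⟨.seq (.testNotDvd (Nat.nth Nat.Prime i)) (.star (.shift (-1, 0))), fun x => ?_⟩
  simp only [CounterProg.Rel.eq_3, CounterProg.rel_testNotDvd (Nat.prime_nth_prime i).two_le,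
    nth_prime_dvd_registerCode, not_not, CounterProg.rel_star_shift]
  constructor
  · rintro ⟨_, h, -⟩
    exact h.2
  · intro h
    exact ⟨_, ⟨rfl, h⟩, registerCode x, by simp [Prod.ext_iff]⟩

/-- Decrementing both registers together preserves whether they are equal, and equal registers reach
`0` simultaneously. -/
theorem eq_register {i j : ℕ} (hij : i ≠ j) : Checkable fun x => x i = x j := by
  refine (comp ((Executable.dec i).seq (.dec j)).star ((eq_zero i).and (eq_zero j))).of_iff
    fun x => ?_
  constructor
  · intro h
    generalize hn : x j = n
    induction n generalizing x with
    | zero => exact ⟨x, .refl, h.trans hn, hn⟩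
    | succ n ih =>
      obtain ⟨y, rfl⟩ := Finsupp.exists_eq_add_single (x := x) (i := i) (by omega)
      obtain ⟨z, rfl⟩ := Finsupp.exists_eq_add_single (x := y) (i := j) (by
        simp [hij] at hn; omega)
      simp [hij, hij.symm] at h hn
      obtain ⟨u, hu, h0⟩ := ih z h hn
      exact ⟨u, hu.head ⟨_, rfl, rfl⟩, h0⟩
  · rintro ⟨y, hy, h⟩
    refine Relation.ReflTransGen.head_induction_on (motive := fun x _ => x i = x j) hy
      (h.1.trans h.2.symm) ?_
    rintro _ z ⟨_, rfl, rfl⟩ - hz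
    simp [hij, hij.symm, hz]

theorem eq_succ_register {i j : ℕ} (hij : i ≠ j) : Checkable fun x => x i = x j + 1 := by
  refine (comp (.dec i) (eq_register hij)).of_iff fun x => ?_
  constructor
  · intro h
    obtain ⟨y, rfl⟩ := Finsupp.exists_eq_add_single (x := x) (i := i) (by omega)
    exact ⟨y, rfl, by simpa [hij] using h⟩
  · rintro ⟨y, rfl, h⟩
    simp [hij, h]

theorem forall_fin {n : ℕ} {P : Fin n → (ℕ →₀ ℕ) → Prop} (h : ∀ i, Checkable (P i)) :
    Checkable fun x => ∀ i, P i x := by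
  induction n with
  | zero => exact true.of_iff fun x => by simp
  | succ n ih => exact ((h 0).and (ih fun i => h i.succ)).of_iff fun x => Fin.forall_fin_succ

theorem exists_agree (T : Finset ℕ) (hP : Checkable P) :
    Checkable fun x => ∃ y : ℕ →₀ ℕ, (∀ t ∉ T, y t = x t) ∧ P y := by
  induction T using Finset.induction_on with
  | empty =>
    refine hP.of_iff fun x => ⟨fun ⟨y, hy, h⟩ => ?_, fun h => ⟨x, fun _ _ => rfl, h⟩⟩
    rwa [← Finsupp.ext fun t => hy t (by simp)]
  | insert i T _ ih =>
    refine (ih.exists_update i).of_iff fun x => ⟨?_, ?_⟩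
    · rintro ⟨y, hy, h⟩
      refine ⟨y i, y, fun t ht => ?_, h⟩
      by_cases hti : t = i
      · subst hti; simp
      · simpa [hti] using hy t (by simp [hti, ht])
    · rintro ⟨a, y, hy, h⟩
      refine ⟨y, fun t ht => ?_, h⟩
      rw [Finset.mem_insert, not_or] at ht
      simpa [ht.1] using hy t ht.2

end Checkable

/-! ### Graphs of primitive recursive functions -/

/-- The graph of a function can be checked, wherever the arguments and the value are stored. -/
def GraphCheckable {n : ℕ} (f : List.Vector ℕ n → ℕ) : Prop :=
  ∀ (r : Fin n → ℕ) (o : ℕ), (∀ i, r i ≠ o) →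
    Checkable fun x => x o = f (List.Vector.ofFn fun i => x (r i))

namespace GraphCheckable

theorem zero : GraphCheckable (n := 0) fun _ => 0 := fun _ o _ => Checkable.eq_zero o

theorem succ : GraphCheckable (n := 1) fun v => v.head.succ := fun _ _ h =>
  Checkable.eq_succ_register (h 0).symm

theorem get {n : ℕ} (i : Fin n) : GraphCheckable fun v => v.get i := fun r _ h =>
  (Checkable.eq_register (h i).symm).of_iff fun x => by simp

theorem comp {m n : ℕ} {f : List.Vector ℕ n → ℕ} {g : Fin n → List.Vector ℕ m → ℕ}
    (hf : GraphCheckable f) (hg : ∀ i, GraphCheckable (g i)) :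
    GraphCheckable fun v => f (List.Vector.ofFn fun i => g i v) := by
  intro r o _
  obtain ⟨s, hs⟩ : ∃ s, o < s ∧ ∀ i, r i < s := by
    obtain ⟨b, hb⟩ := (Set.finite_range r).bddAbove
    exact ⟨max o b + 1, by omega, fun i => by have := hb ⟨i, rfl⟩; omega⟩
  -- The inner values are guessed in the fresh registers `s, …, s + n - 1`, then all graphs are
  -- checked.
  have hC := ((Checkable.forall_fin fun i : Fin n =>
    hg i r (s + i) fun j => by have := hs.2 j; omega).and
      (hf (fun i => s + i) o fun i => by omega)).exists_agree (Finset.Ico s (s + n))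
  refine hC.of_iff fun x => ⟨fun h => ?_, ?_⟩
  · let a (t : ℕ) : ℕ := if ht : t - s < n then
      g ⟨t - s, ht⟩ (List.Vector.ofFn fun i => x (r i)) else 0
    let y : ℕ →₀ ℕ := Finsupp.onFinset (x.support ∪ Finset.Ico s (s + n))
      (fun t => if t ∈ Finset.Ico s (s + n) then a t else x t) (by
        intro t ht
        by_cases h : t ∈ Finset.Ico s (s + n)
        · exact Finset.mem_union_right _ h
        · rw [if_neg h] at ht
          exact Finset.mem_union_left _ (Finsupp.mem_support_iff.2 ht))
    have hy (t : ℕ) (ht : t ∉ Finset.Ico s (s + n)) : y t = x t := if_neg ht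
    have hyr (i : Fin m) : y (r i) = x (r i) :=
      hy _ (by have := hs.2 i; simp; omega)
    have hya (i : Fin n) : y (s + i) = g i (List.Vector.ofFn fun i => x (r i)) := by
      have : y (s + i) = a (s + i) := if_pos (by simp)
      rw [this]
      simp [a]
    refine ⟨y, hy, fun i => ?_, ?_⟩
    · simp only [hyr, hya]
    · simp only [hya]
      rw [hy o (by simp; omega), h]
  · rintro ⟨y, hy, h, ho⟩
    have hyr (i : Fin m) : y (r i) = x (r i) :=
      hy _ (by have := hs.2 i; simp; omega)
    simp only [hyr] at h
    rw [← hy o (by simp; omega), ho]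
    simp only [h]

/-- The loop body of a primitive recursion: the register `s` is the loop counter, `s + 1` is the
accumulator and `s + 2` is auxiliary. -/
theorem executable_loop {n : ℕ} {g : List.Vector ℕ (n + 2) → ℕ} (hg : GraphCheckable g)
    (r : Fin n → ℕ) (s : ℕ) (hs : ∀ i, r i < s) :
    Executable fun x y => ∃ b,
      b = g (x s ::ᵥ x (s + 1) ::ᵥ List.Vector.ofFn fun i => x (r i)) ∧
      y = (x.update (s + 2) b).update (s + 1) b + Finsupp.single s 1 := by
  have h1 := (Executable.havoc (s + 2)).seq (.test (hg
    (Fin.cons s (Fin.cons (s + 1) r)) (s + 2) (Fin.cases (by simp) (Fin.cases (by simp)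
      fun i => by have := hs i; simp only [Fin.cons_succ]; omega))))
  -- The old accumulator is an argument of `g`, so it is overwritten only after the new value has
  -- been checked in `s + 2`.
  have h2 := (Executable.havoc (s + 1)).seq
    (.test (Checkable.eq_register (show s + 2 ≠ s + 1 by omega)))
  refine ((h1.seq h2).seq (.inc s)).of_iff fun x y => ?_
  have hr (i : Fin n) : r i ≠ s + 2 := by have := hs i; omega
  have key (b : ℕ) : (List.Vector.ofFn fun i => (x.update (s + 2) b)
      ((Fin.cons s (Fin.cons (s + 1) r) : Fin (n + 2) → ℕ) i)) =
      x s ::ᵥ x (s + 1) ::ᵥ List.Vector.ofFn fun i => x (r i) := by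
    simp [List.Vector.ofFn, hr]
  constructor
  · rintro ⟨b, hb, rfl⟩
    exact ⟨_, ⟨_, ⟨_, ⟨b, rfl⟩, rfl, by rw [key, ← hb]; simp⟩, _, ⟨b, rfl⟩, rfl, by simp⟩, rfl⟩
  · rintro ⟨_, ⟨_, ⟨_, ⟨b, rfl⟩, rfl, hb⟩, _, ⟨c, rfl⟩, rfl, hc⟩, rfl⟩
    rw [key] at hb
    simp at hb hc
    subst hc
    exact ⟨b, hb, rfl⟩

/-- Counter and accumulator are guessed as `0` and the value of `f`; the loop runs a guessed number
of times, and at the end they must equal the recursion argument and the output. -/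
theorem prec {n : ℕ} {f : List.Vector ℕ n → ℕ} {g : List.Vector ℕ (n + 2) → ℕ}
    (hf : GraphCheckable f) (hg : GraphCheckable g) :
    GraphCheckable fun v : List.Vector ℕ (n + 1) =>
      v.head.rec (f v.tail) fun y IH => g (y ::ᵥ IH ::ᵥ v.tail) := by
  intro r o _
  obtain ⟨s, ho, hr⟩ : ∃ s, o < s ∧ ∀ i, r i < s := by
    obtain ⟨b, hb⟩ := (Set.finite_range r).bddAbove
    exact ⟨max o b + 1, by omega, fun i => by have := hb ⟨i, rfl⟩; omega⟩
  have hloop := (executable_loop hg (fun i => r i.succ) s fun i => hr _).star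
  have hend := (Checkable.eq_register (i := s) (j := r 0) (hr 0).ne').and
    (Checkable.eq_register (i := s + 1) (j := o) (by omega))
  have hstart := (Checkable.eq_zero s).and
    (hf (fun i => r i.succ) (s + 1) fun i => by have := hr i.succ; omega)
  refine ((hstart.and (.comp hloop hend)).exists_agree {s, s + 1}).of_iff fun x => ?_
  clear hloop hend hstart
  set R : (ℕ →₀ ℕ) → (ℕ →₀ ℕ) → Prop := fun x y => ∃ b,
      b = g (x s ::ᵥ x (s + 1) ::ᵥ List.Vector.ofFn fun i => x (r i.succ)) ∧
      y = (x.update (s + 2) b).update (s + 1) b + Finsupp.single s 1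
  set v := List.Vector.ofFn fun i => x (r i.succ) with hv
  let F (k : ℕ) : ℕ := k.rec (f v) fun y IH => g (y ::ᵥ IH ::ᵥ v)
  change x o = F (x (r 0)) ↔ _
  -- Loop invariant: registers below `s` are unchanged and the accumulator is `F` of the counter.
  have hstep {y z : ℕ →₀ ℕ} (hyz : R y z) (hy : ∀ t < s, y t = x t) (hF : y (s + 1) = F (y s)) :
      (∀ t < s, z t = x t) ∧ z (s + 1) = F (z s) ∧ z s = y s + 1 := by
    obtain ⟨b, hb, rfl⟩ := hyz
    have : (List.Vector.ofFn fun i => y (r i.succ)) = v := by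
      simp only [hv, hy _ (hr _)]
    rw [this, hF] at hb
    refine ⟨fun t ht => ?_, ?_, ?_⟩
    · simp [ht.ne, (show t ≠ s + 1 by omega), (show t ≠ s + 2 by omega), hy t ht]
    · simp [hb, F]
    · simp
  constructor
  · intro h
    let y := (x.update s 0).update (s + 1) (f v)
    have hy (t : ℕ) (ht : t < s) : y t = x t := by
      simp [y, ht.ne, (show t ≠ s + 1 by omega)]
    have hys : y s = 0 := by simp [y]
    have hF : y (s + 1) = f v := by simp [y]
    refine ⟨y, fun t ht => ?_, ⟨hys, ?_⟩, ?_⟩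
    · simp only [Finset.mem_insert, Finset.mem_singleton, not_or] at ht
      simp [y, ht.1, ht.2]
    · rw [hF]
      simp only [hy _ (hr _), hv]
    · have H (k : ℕ) : ∃ z, Relation.ReflTransGen R y z ∧ (∀ t < s, z t = x t) ∧
          z (s + 1) = F (z s) ∧ z s = k := by
        induction k with
        | zero => exact ⟨y, .refl, hy, by rw [hF, hys]; rfl, hys⟩
        | succ k ih =>
          obtain ⟨z, hz, h1, h2, rfl⟩ := ih
          have hzu : R z _ := ⟨_, rfl, rfl⟩
          obtain ⟨h3, h4, h5⟩ := hstep hzu h1 h2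
          exact ⟨_, hz.tail hzu, h3, h4, h5⟩
      obtain ⟨z, hz, h1, h2, h3⟩ := H (x (r 0))
      exact ⟨z, hz, by rw [h3, h1 _ (hr 0)], by rw [h2, h3, h1 o ho, h]⟩
  · rintro ⟨y, hy, ⟨hys, hyf⟩, z, hyz, hz0, hzo⟩
    have hy' (t : ℕ) (ht : t < s) : y t = x t := hy t (by simp; omega)
    simp only [hy' _ (hr _)] at hyf
    have : (∀ t < s, z t = x t) ∧ z (s + 1) = F (z s) := by
      clear hz0 hzo
      induction hyz with
      | refl => exact ⟨hy', by rw [hyf, hys]; rfl⟩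
      | tail _ hyz ih =>
        have := hstep hyz ih.1 ih.2
        exact ⟨this.1, this.2.1⟩
    rw [← this.1 o ho, ← hzo, this.2, hz0, this.1 _ (hr 0)]

theorem of_primrec {n : ℕ} {f : List.Vector ℕ n → ℕ} (hf : Nat.Primrec' f) :
    GraphCheckable f := by
  induction hf with
  | zero => exact zero
  | succ => exact succ
  | get i => exact get i
  | comp g _ _ ihf ihg => exact comp ihf ihg
  | prec _ _ ihf ihg => exact prec ihf ihg

end GraphCheckable

/-! ### Reduction from the halting problem -/

/-- Recursively enumerable sets can be checked by programs. -/
theorem CounterProg.exists_rel_iff {f : ℕ → ℕ → ℕ} (hf : Primrec₂ f) :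
    ∃ p : CounterProg, ∀ n : ℕ, p.Rel ((2 ^ n : ℕ), 0) 0 ↔ ∃ k, f k n = 0 := by
  -- Register `0` holds `n`, which makes the initial code `2 ^ n`; `k` and the value are guessed in
  -- registers `1` and `2`.
  have h := GraphCheckable.of_primrec (Nat.Primrec'.prim_iff₂.2 hf) ![1, 0] 2 (by
    intro i; fin_cases i <;> simp)
  obtain ⟨p, hp⟩ := ((h.and (.eq_zero 2)).exists_update 2).exists_update 1
  refine ⟨p, fun n => ?_⟩
  have := hp (Finsupp.single 0 n)
  rw [registerCode_single, Nat.nth_prime_zero_eq_two] at this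
  rw [this]
  simp [List.Vector.ofFn]

/-- Here `k` bounds the evaluation. An option is encoded as `0` exactly when it is `none`, so `1 -
encode` vanishes exactly on success. -/
theorem exists_primrec_halting :
    ∃ f : ℕ → ℕ → ℕ, Primrec₂ f ∧
      ∀ c : Nat.Partrec.Code, (c.eval 0).Dom ↔ ∃ k, f k (Encodable.encode c) = 0 := by
  refine ⟨fun k n => 1 - Encodable.encode (Nat.Partrec.Code.evaln k
    (Denumerable.ofNat Nat.Partrec.Code n) 0), ?_, fun c => ?_⟩
  · exact Primrec.nat_sub.comp (.const 1) (Primrec.encode.comp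
      (Nat.Partrec.Code.primrec_evaln.comp
        ((Primrec.fst.pair ((Primrec.ofNat _).comp .snd)).pair (.const 0))))
  · rw [Part.dom_iff_mem]
    simp only [Nat.Partrec.Code.evaln_complete, Denumerable.ofNat_encode]
    rw [exists_comm]
    refine exists_congr fun k => ?_
    cases Nat.Partrec.Code.evaln k c 0 <;> simp

/-- A description of `inputPTA`. -/
def inputPTACode (m : ℕ) {k : ℕ}
    (T : List (PTARTransition m (Fin (k + 1)) (fun σ : Fin 3 => (σ : ℕ)))) (q : Fin (k + 1))
    (n : ℕ) : PTARCode m :=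
  ⟨k + 1, [0, 1, 2], 0, (0, 1, [((q : ℕ), some (inputVector m n))]) :: T.map PTARTransition.code,
    [(0, [1])]⟩

theorem inputPTACode_describes (m : ℕ) {k : ℕ}
    (T : List (PTARTransition m (Fin (k + 1)) (fun σ : Fin 3 => (σ : ℕ)))) (q : Fin (k + 1))
    (n : ℕ) : (inputPTACode m T q n).Describes (inputPTA m T q n) where
  numStates_eq := rfl
  ranks_eq := rfl
  init_eq := rfl
  mem_trans x := by
    change x ∈ (inputTransition m q n :: T).map PTARTransition.code ↔ _
    exact List.mem_map
  accept_eq := by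
    ext w
    simp only [inputPTA, inputPTACode, linearSetOf, List.mem_singleton, Set.iUnion_iUnion_eq_left,
      Set.mem_ofPred_eq, zero_add]
    constructor
    · rintro ⟨a, ha⟩
      exact ⟨fun _ => a, by ext i; simp [ha]⟩
    · rintro ⟨a, rfl⟩
      exact ⟨a ⟨0, by simp⟩, fun i => by simp⟩

/-- All entries are constants except the vector of the input transition. -/
theorem primrec_inputPTACode (m : ℕ) {k : ℕ}
    (T : List (PTARTransition m (Fin (k + 1)) (fun σ : Fin 3 => (σ : ℕ)))) (q : Fin (k + 1)) :
    Primrec (inputPTACode m T q) := by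
  have hv : Primrec (inputVector m) :=
    Primrec.fin_curry.2 (Primrec.ite (Primrec.eq.comp (Primrec.fin_val.comp .snd) (.const 0))
      .fst (.const 0))
  have htrans : Primrec fun n : ℕ =>
      ((0, 1, [((q : ℕ), some (inputVector m n))]) :: T.map PTARTransition.code :
        List (ℕ × ℕ × List (ℕ × StorageOp m))) :=
    Primrec.list_cons.comp ((Primrec.const 0).pair ((Primrec.const 1).pair
      (Primrec.list_cons.comp ((Primrec.const (q : ℕ)).pair (Primrec.option_some.comp hv))
        (.const [])))) (.const _)
  exact (Primrec.of_equiv_symm (e := PTARCode.equivProd m)).comp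
    ((Primrec.const (k + 1)).pair ((Primrec.const [0, 1, 2]).pair ((Primrec.const 0).pair
      (htrans.pair (.const [(0, [1])])))))

/-- For every `m ≥ 3`, non-emptiness of `m`-PTA is undecidable. -/
theorem theorem2 (m : ℕ) (hm : 3 ≤ m) :
    ¬ ∃ decider : PTARCode m → Bool, Computable decider ∧
      ∀ (k s : ℕ) (rk : Fin s → ℕ) (A : PTAR m (Fin k) rk) (c : PTARCode m),
        A.IsPTA → c.Describes A → (decider c = true ↔ A.language.Nonempty) := by
  rintro ⟨decider, hcomp, hdec⟩
  obtain ⟨f, hf, hhalt⟩ := exists_primrec_halting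
  obtain ⟨p, hp⟩ := CounterProg.exists_rel_iff hf
  obtain ⟨k, T, q, hT, hL⟩ := CounterProg.exists_inputPTA hm p
  refine ComputablePred.halting_problem 0 (ComputablePred.computable_iff.2
    ⟨fun c => decider (inputPTACode m T q (2 ^ Encodable.encode c)), ?_, ?_⟩)
  · have hpow : Primrec fun n : ℕ => 2 ^ n := by
      refine (Primrec.nat_rec' Primrec.id (.const 1)
        (Primrec.nat_mul.comp (.const 2) (Primrec.snd.comp .snd)).to₂).of_eq fun n => ?_
      induction n with
      | zero => rfl
      | succ n ih => simpa [pow_succ'] using ih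
    exact hcomp.comp ((primrec_inputPTACode m T q).comp (hpow.comp .encode)).to_comp
  · funext c
    have hPTA (n : ℕ) : (inputPTA m T q n).IsPTA := by
      intro τ hτ
      rcases List.mem_cons.1 hτ with rfl | hτ
      · exact fun _ => Option.some_ne_none _
      · exact hT τ hτ
    rw [hdec _ _ _ _ _ (hPTA _) (inputPTACode_describes m T q _), hL, hp, hhalt]
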